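/- Let $R$ be a commutative ring with identity; all modules are unitary $R$-modules. For an $R$-module $M$ let $\mathrm{pd}_R(M)$ and $\mathrm{fd}_R(M)$ denote its projective and flat dimension, with values in $\{0,1,2,\dots\}\cup\{\infty\}$ (the zero module has both dimensions equal to $0$). The cotorsion dimension $\mathrm{cd}_R(M)$ is the least integer $n\ge 0$ such that $\mathrm{Ext}^{n+1}_R(F,M)=0$ for all flat $R$-modules $F$, and $\infty$ if there is no such $n$. Define, as elements of $\{0,1,2,\dots\}\cup\{\infty\}$, $$\mathrm{FPD}(R)=\sup\{\mathrm{pd}_R(M) : M \text{ an } R\text{-module with } \mathrm{pd}_R(M)<\infty\},$$ $$\mathrm{FFD}(R)=\sup\{\mathrm{fd}_R(M) : M \text{ an } R\text{-module with } \mathrm{fd}_R(M)<\infty\},$$ $$\mathrm{cot.D}(R)=\sup\{\mathrm{cd}_R(M) : M \text{ an } R\text{-module}\}.$$ Theorem. For every commutative ring $R$, $$\mathrm{FFD}(R)\le \mathrm{FPD}(R)\le \mathrm{cot.D}(R)+\mathrm{FFD}(R).$$ -/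

import Mathlib

universe u

open CategoryTheory

noncomputable section

/-- `HasFlatResolutionOfLength R n M`: there is an exact sequence
`0 → F_n → ⋯ → F_1 → F_0 → M → 0` of `R`-modules with all `F_i` flat.
The sequence is presented as `n` short exact sequences `0 → K → F → M → 0` (`F` flat) spliced
together, the last kernel being flat. -/
def HasFlatResolutionOfLength (R : Type u) [CommRing R] : ℕ → ModuleCat.{u} R → Prop
  | 0, M => Module.Flat R M
  | n + 1, M => ∃ (K F : ModuleCat.{u} R) (f : K →ₗ[R] F) (g : F →ₗ[R] M),
      Function.Injective f ∧ Function.Exact f g ∧ Function.Surjective g ∧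
      Module.Flat R F ∧ HasFlatResolutionOfLength R n K

/-- The flat dimension `fd_R(M)`: the least length of a flat resolution of `M`,
and `⊤` if there is no finite one. -/
def flatDim {R : Type u} [CommRing R] (M : ModuleCat.{u} R) : ℕ∞ :=
  ⨅ (n : ℕ) (_ : HasFlatResolutionOfLength R n M), (n : ℕ∞)

/-- The projective dimension `pd_R(M)` with values in `ℕ∞`. It is Mathlib's projective dimension,
except that the zero module has projective dimension `0` (and not `⊥`). -/
def projDim {R : Type u} [CommRing R] (M : ModuleCat.{u} R) : ℕ∞ :=
  (projectiveDimension M).unbotD 0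

/-- The cotorsion dimension `cd_R(M)`: the least natural number `n` such that
`Ext^{n+1}_R(F, M) = 0` for all flat `R`-modules `F`, and `⊤` if there is none. -/
def cotorsionDim {R : Type u} [CommRing R] (M : ModuleCat.{u} R) : ℕ∞ :=
  ⨅ (n : ℕ) (_ : ∀ F : ModuleCat.{u} R, Module.Flat R F →
      Subsingleton (Abelian.Ext.{u} F M (n + 1))), (n : ℕ∞)

/-- The global cotorsion dimension `cot.D(R)`. -/
def globalCotorsionDim (R : Type u) [CommRing R] : ℕ∞ :=
  ⨆ M : ModuleCat.{u} R, cotorsionDim M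

/-- The finitistic projective dimension `FPD(R)`: the supremum of the finite
projective dimensions of `R`-modules. -/
def finitisticProjDim (R : Type u) [CommRing R] : ℕ∞ :=
  ⨆ (M : ModuleCat.{u} R) (_ : projDim M < ⊤), projDim M

/-- The finitistic flat dimension `FFD(R)`: the supremum of the finite
flat dimensions of `R`-modules. -/
def finitisticFlatDim (R : Type u) [CommRing R] : ℕ∞ :=
  ⨆ (M : ModuleCat.{u} R) (_ : flatDim M < ⊤), flatDim M

end

/-! Projectives are flat, so fd ≤ pd; and if every flat module has pd at most `c`, then pd M ≤ `c` +
fd M by induction along a flat resolution. Both inequalities thus reduce to bounding pd on flat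
modules. If cot.D = `c`, then Ext^{c+1}(F, -) vanishes for flat F, so pd F ≤ `c`. If FPD = `n` is
finite, Jensen's theorem `Module.Flat.hasProjectiveDimensionLT_of_bounded` gives pd F ≤ `n`; a
module of finite flat dimension then has finite pd, hence pd ≤ FPD.

For Jensen's theorem, let K be the kernel of a map from a free module onto F. Each finite subset of
K is fixed by an endomorphism of the free module with finitely generated range in K. Spans of
countable subsets closed under this operation are projective. Larger closed sets are exhausted by
smaller ones, and Auslander's lemma controls the union at the cost of one dimension, which the bound
FPD = `n` gives back. -/

/-! ### Dimension shifting along projective presentations. -/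

theorem HasProjectiveDimensionLT.of_ker_of_projective {R : Type u} [CommRing R] {M N : Type u}
    [AddCommGroup M] [AddCommGroup N] [Module R M] [Module R N] [Module.Projective R M]
    (f : M →ₗ[R] N) (hf : Function.Surjective f) (n : ℕ)
    (h : HasProjectiveDimensionLT (ModuleCat.of R (LinearMap.ker f)) (n + 1)) :
    HasProjectiveDimensionLT (ModuleCat.of R N) (n + 2) := by
  have hP : Projective (ModuleCat.of R M) :=
    (IsProjective.iff_projective M).1 inferInstance
  exact ((LinearMap.shortExact_shortComplexKer hf).hasProjectiveDimensionLT_X₃_iff n hP).2 h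

theorem HasProjectiveDimensionLT.ker_of_projective {R : Type u} [CommRing R] {M N : Type u}
    [AddCommGroup M] [AddCommGroup N] [Module R M] [Module R N] [Module.Projective R M]
    (f : M →ₗ[R] N) (hf : Function.Surjective f) (n : ℕ)
    (h : HasProjectiveDimensionLT (ModuleCat.of R N) (n + 2)) :
    HasProjectiveDimensionLT (ModuleCat.of R (LinearMap.ker f)) (n + 1) := by
  have hP : Projective (ModuleCat.of R M) :=
    (IsProjective.iff_projective M).1 inferInstance
  exact ((LinearMap.shortExact_shortComplexKer hf).hasProjectiveDimensionLT_X₃_iff n hP).1 h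

theorem hasProjectiveDimensionLT_one_iff_module_projective {R : Type u} [CommRing R]
    (M : Type u) [AddCommGroup M] [Module R M] :
    HasProjectiveDimensionLT (ModuleCat.of R M) 1 ↔ Module.Projective R M := by
  rw [← projective_iff_hasProjectiveDimensionLT_one, ← IsProjective.iff_projective]

/-! ### Well-ordered filtrations and Auslander's lemma. -/

namespace Submodule

variable {R : Type u} [CommRing R] {N : Type u} [AddCommGroup N] [Module R N]
  {J : Type u} [LinearOrder J]

/-- The supremum of the terms of a family of submodules strictly below a given index. -/
def strictSup (S : J → Submodule R N) (j : J) : Submodule R N :=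
  ⨆ i : Set.Iio j, S i

theorem le_strictSup (S : J → Submodule R N) {i j : J} (h : i < j) : S i ≤ strictSup S j :=
  le_iSup (fun i : Set.Iio j => S i) ⟨i, h⟩

theorem mem_strictSup {S : J → Submodule R N} (hS : Monotone S) {j : J} {x : N} :
    x ∈ strictSup S j ↔ x = 0 ∨ ∃ i < j, x ∈ S i := by
  constructor
  · intro hx
    rcases isEmpty_or_nonempty (Set.Iio j) with hj | hj
    · left
      rwa [strictSup, iSup_of_empty, mem_bot] at hx
    · right
      have hd : Directed (· ≤ ·) (fun i : Set.Iio j => S i) :=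
        Monotone.directed_le fun a b hab => hS hab
      obtain ⟨⟨i, hi⟩, hx⟩ := (mem_iSup_of_directed _ hd).1 hx
      exact ⟨i, hi, hx⟩
  · rintro (rfl | ⟨i, hi, hx⟩)
    · exact zero_mem _
    · exact le_strictSup S hi hx

variable [WellFoundedLT J] {S : J → Submodule R N} {Q : J → Type u}
  [∀ j, AddCommGroup (Q j)] [∀ j, Module R (Q j)]

/-- A module with a well-ordered filtration with projective quotients is projective. -/
theorem projective_of_filtration (htop : ⨆ j, S j = ⊤)
    (q : ∀ j, S j →ₗ[R] Q j) (hq : ∀ j, Function.Surjective (q j))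
    (hker : ∀ j x, q j x = 0 ↔ (x : N) ∈ strictSup S j)
    [∀ j, Module.Projective R (Q j)] : Module.Projective R N := by
  classical
  choose s hs using fun j => Module.projective_lifting_property (q j) LinearMap.id (hq j)
  have hs' (j : J) (y : Q j) : q j (s j y) = y := LinearMap.congr_fun (hs j) y
  -- The sections `s j` assemble to an isomorphism: surjective by well-founded induction, injective
  -- by looking at the leading (largest) index.
  let Φ : (Π₀ j, Q j) →ₗ[R] N := DFinsupp.lsum ℕ fun j => (S j).subtype ∘ₗ s j
  have hΦ (j : J) (y : Q j) : Φ (DFinsupp.single j y) = s j y := by simp [Φ]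
  have hsurj (j : J) : S j ≤ LinearMap.range Φ := by
    induction j using WellFoundedLT.induction with
    | _ j ih =>
      intro x hx
      have h1 : x - s j (q j ⟨x, hx⟩) ∈ strictSup S j := by
        have := (hker j (⟨x, hx⟩ - s j (q j ⟨x, hx⟩))).1 (by rw [map_sub, hs', sub_self])
        simpa using this
      have h2 : strictSup S j ≤ LinearMap.range Φ := iSup_le fun i => ih i i.2
      have h3 : (s j (q j ⟨x, hx⟩) : N) ∈ LinearMap.range Φ := ⟨_, hΦ j _⟩
      simpa using add_mem (h2 h1) h3
  have hinj : LinearMap.ker Φ = ⊥ := by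
    rw [LinearMap.ker_eq_bot']
    intro x hx
    by_contra hne
    have hsupp : x.support.Nonempty := by
      rwa [Finset.nonempty_iff_ne_empty, Ne, DFinsupp.support_eq_empty]
    set j := x.support.max' hsupp with hj
    have hjs : j ∈ x.support := Finset.max'_mem _ _
    have hsum : Φ x = ∑ i ∈ x.support, (s i (x i) : N) := by
      conv_lhs => rw [← DFinsupp.sum_single (f := x)]
      rw [DFinsupp.sum, map_sum]
      simp only [hΦ]
    rw [hsum, ← Finset.add_sum_erase _ _ hjs] at hx
    have hmem : (s j (x j) : N) ∈ strictSup S j := by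
      rw [eq_neg_of_add_eq_zero_left hx]
      refine neg_mem (sum_mem fun i hi => ?_)
      have hlt : i < j := lt_of_le_of_ne (Finset.le_max' _ _ (Finset.mem_of_mem_erase hi))
        (Finset.ne_of_mem_erase hi)
      exact le_strictSup S hlt (s i (x i)).2
    rw [← hker, hs'] at hmem
    exact (DFinsupp.mem_support_iff.1 hjs) hmem
  have hrange : LinearMap.range Φ = ⊤ := top_le_iff.1 (htop ▸ iSup_le hsurj)
  exact Module.Projective.of_equiv (LinearEquiv.ofBijective Φ
    ⟨LinearMap.ker_eq_bot.1 hinj, LinearMap.range_eq_top.1 hrange⟩)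

/-- **Auslander's lemma**: a bound on the projective dimensions of the quotients of a well-ordered
filtration bounds the projective dimension of the module. -/
theorem hasProjectiveDimensionLT_of_filtration (n : ℕ) {N : Type u} [AddCommGroup N] [Module R N]
    {S : J → Submodule R N} {Q : J → Type u} [∀ j, AddCommGroup (Q j)] [∀ j, Module R (Q j)]
    (hS : Monotone S) (htop : ⨆ j, S j = ⊤)
    (q : ∀ j, S j →ₗ[R] Q j) (hq : ∀ j, Function.Surjective (q j))
    (hker : ∀ j x, q j x = 0 ↔ (x : N) ∈ strictSup S j)
    (h : ∀ j, HasProjectiveDimensionLT (ModuleCat.of R (Q j)) (n + 1)) :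
    HasProjectiveDimensionLT (ModuleCat.of R N) (n + 1) := by
  classical
  induction n generalizing N Q with
  | zero =>
    have (j : J) : Module.Projective R (Q j) :=
      (hasProjectiveDimensionLT_one_iff_module_projective _).1 (h j)
    exact (hasProjectiveDimensionLT_one_iff_module_projective _).2
      (projective_of_filtration htop q hq hker)
  | succ n ih =>
    -- One free module mapping onto every `S j`: its basis is `N`, and basis elements outside `S j`
    -- go to `0`.
    obtain ⟨G, _, _, _, f, hf⟩ : ∃ (G : Type u) (_ : AddCommGroup G) (_ : Module R G)
        (_ : Module.Projective R G) (f : ∀ j, G →ₗ[R] S j), ∀ j, Function.Surjective (f j) := by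
      refine ⟨N →₀ R, inferInstance, inferInstance, inferInstance,
        fun j => Finsupp.linearCombination R fun x => if hx : x ∈ S j then ⟨x, hx⟩ else 0,
        fun j x => ⟨Finsupp.single (x : N) 1, ?_⟩⟩
      simp
    obtain ⟨π, hπs⟩ : ∃ π : (J →₀ G) →ₗ[R] N,
        ∀ j g, π (Finsupp.single j g) = f j g :=
      ⟨Finsupp.lsum ℕ fun j => (S j).subtype ∘ₗ f j, fun j g => by simp⟩
    have hπ : Function.Surjective π := by
      rw [← LinearMap.range_eq_top, ← top_le_iff, ← htop]
      refine iSup_le fun j x hx => ?_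
      obtain ⟨g, hg⟩ := hf j ⟨x, hx⟩
      exact ⟨Finsupp.single j g, by rw [hπs, hg]⟩
    -- The kernel is filtered by support in indices ≤ `j`. The `j`-th coordinate identifies the
    -- quotients with `L j`, a syzygy of `Q j`, so the induction hypothesis applies.
    let S' (j : J) : Submodule R (LinearMap.ker π) :=
      (Finsupp.supported G R (Set.Iic j)).comap (LinearMap.ker π).subtype
    have hmem (j : J) (x : LinearMap.ker π) :
        x ∈ S' j ↔ ∀ i, (x : J →₀ G) i ≠ 0 → i ≤ j := by
      simp only [S', Submodule.mem_comap, Submodule.subtype_apply, Finsupp.mem_supported]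
      simp [Set.subset_def]
    have hS' : Monotone S' := fun i j hij x hx => by
      rw [hmem] at hx ⊢
      exact fun k hk => (hx k hk).trans hij
    have hmax (x : LinearMap.ker π) : x = 0 ∨ ∃ i, (x : J →₀ G) i ≠ 0 ∧ x ∈ S' i := by
      rcases (x : J →₀ G).support.eq_empty_or_nonempty with he | he
      · left
        exact Subtype.ext (Finsupp.support_eq_empty.1 he)
      · right
        refine ⟨_, Finsupp.mem_support_iff.1 (Finset.max'_mem _ he), (hmem _ _).2 fun i hi => ?_⟩
        exact Finset.le_max' _ _ (Finsupp.mem_support_iff.2 hi)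
    have hlast (j : J) (x : S' j) : q j (f j (((x : LinearMap.ker π) : J →₀ G) j)) = 0 := by
      obtain ⟨⟨x, hx0⟩, hx⟩ := x
      rw [hmem] at hx
      rw [hker]
      have hsum : π x = ∑ i ∈ insert j x.support, (f i (x i) : N) := by
        conv_lhs => rw [← Finsupp.sum_single x]
        rw [Finsupp.sum, map_sum]
        simp only [hπs]
        refine Finset.sum_subset (Finset.subset_insert _ _) fun i _ hi => ?_
        rw [Finsupp.notMem_support_iff.1 hi, map_zero, ZeroMemClass.coe_zero]
      rw [LinearMap.mem_ker, hsum, ← Finset.add_sum_erase _ _ (Finset.mem_insert_self _ _)] at hx0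
      rw [eq_neg_of_add_eq_zero_left hx0]
      refine neg_mem (sum_mem fun i hi => ?_)
      have hne := Finset.ne_of_mem_erase hi
      have his : i ∈ x.support := (Finset.mem_insert.1 (Finset.mem_of_mem_erase hi)).resolve_left hne
      exact le_strictSup S (lt_of_le_of_ne (hx i (Finsupp.mem_support_iff.1 his)) hne)
        (f i (x i)).2
    let L (j : J) : Submodule R G := LinearMap.ker (q j ∘ₗ f j)
    let q' (j : J) : S' j →ₗ[R] L j :=
      (Finsupp.lapply j ∘ₗ (LinearMap.ker π).subtype ∘ₗ (S' j).subtype).codRestrict _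
        fun x => hlast j x
    have hq'a (j : J) (x : S' j) :
        (q' j x : G) = (((x : LinearMap.ker π) : J →₀ G)) j := rfl
    have : Module.Projective R (J →₀ G) :=
      Module.Projective.of_equiv (finsuppLequivDFinsupp R).symm
    refine HasProjectiveDimensionLT.of_ker_of_projective π hπ n
      (ih (N := LinearMap.ker π) (S := S') (Q := fun j => L j) hS' ?_ q' ?_ ?_ ?_)
    · rw [← top_le_iff]
      intro x _
      rcases hmax x with rfl | ⟨i, -, hi⟩
      · exact zero_mem _
      · exact le_iSup S' i hi
    · rintro j ⟨g, hg⟩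
      rw [LinearMap.mem_ker, LinearMap.comp_apply, hker, mem_strictSup hS] at hg
      rcases hg with hg | ⟨i, hi, hgi⟩
      · have hk : Finsupp.single j g ∈ LinearMap.ker π := by rw [LinearMap.mem_ker, hπs, hg]
        have hm : (⟨_, hk⟩ : LinearMap.ker π) ∈ S' j := by
          rw [hmem]
          intro i hi
          by_contra hle
          exact hi (Finsupp.single_eq_of_ne (by rintro rfl; exact hle le_rfl))
        refine ⟨⟨⟨_, hk⟩, hm⟩, Subtype.ext ?_⟩
        rw [hq'a]
        exact Finsupp.single_eq_same
      -- A term at the lower index `i` cancels the image of `g` without changing the `j`-th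
      -- coordinate.
      · obtain ⟨g', hg'⟩ := hf i ⟨_, hgi⟩
        have hk : Finsupp.single j g - Finsupp.single i g' ∈ LinearMap.ker π := by
          rw [LinearMap.mem_ker, map_sub, hπs, hπs, hg', sub_self]
        have hm : (⟨_, hk⟩ : LinearMap.ker π) ∈ S' j := by
          rw [hmem]
          intro k hk
          by_contra hle
          refine hk ?_
          change (Finsupp.single j g - Finsupp.single i g') k = 0
          rw [Finsupp.sub_apply, Finsupp.single_eq_of_ne (by rintro rfl; exact hle le_rfl),
            Finsupp.single_eq_of_ne (by rintro rfl; exact hle hi.le), sub_zero]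
        refine ⟨⟨⟨_, hk⟩, hm⟩, Subtype.ext ?_⟩
        rw [hq'a]
        change (Finsupp.single j g - Finsupp.single i g') j = g
        rw [Finsupp.sub_apply, Finsupp.single_eq_same, Finsupp.single_eq_of_ne hi.ne', sub_zero]
    · intro j x
      rw [mem_strictSup hS', ← Submodule.coe_eq_zero, hq'a]
      constructor
      · intro hx
        refine (hmax x).imp_right ?_
        rintro ⟨i, hi, hxi⟩
        exact ⟨i, lt_of_le_of_ne ((hmem j x).1 x.2 i hi) (by rintro rfl; exact hi hx), hxi⟩
      · rintro (hx | ⟨i, hi, hx⟩)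
        · rw [hx]; rfl
        · by_contra hne
          exact absurd ((hmem i x).1 hx j hne) (not_le.2 hi)
    · intro j
      exact HasProjectiveDimensionLT.ker_of_projective (q j ∘ₗ f j) ((hq j).comp (hf j)) n (h j)

/-- Auslander's lemma for a well-ordered family of submodules of an ambient module. -/
theorem hasProjectiveDimensionLT_iSup (n : ℕ) {P : Type u} [AddCommGroup P] [Module R P]
    {S : J → Submodule R P} (hS : Monotone S)
    (h : ∀ j, HasProjectiveDimensionLT (ModuleCat.of R (S j)) (n + 2))
    (h' : ∀ j, HasProjectiveDimensionLT (ModuleCat.of R (strictSup S j)) (n + 1)) :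
    HasProjectiveDimensionLT (ModuleCat.of R (⨆ j, S j : Submodule R P)) (n + 2) := by
  have hlt (j : J) : strictSup S j ≤ S j := iSup_le fun i => hS i.2.le
  let e (j : J) : (S j).submoduleOf (⨆ j, S j) ≃ₗ[R] S j := submoduleOfEquivOfLe (le_iSup S j)
  have he (j : J) (x) : (e j x : P) = x := rfl
  have hS' : Monotone fun j => (S j).submoduleOf (⨆ j, S j) :=
    fun i j hij => Submodule.comap_mono (hS hij)
  refine hasProjectiveDimensionLT_of_filtration (n + 1) hS' ?_
    (Q := fun j => S j ⧸ (strictSup S j).submoduleOf (S j))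
    (fun j => ((strictSup S j).submoduleOf (S j)).mkQ ∘ₗ (e j).toLinearMap) ?_ ?_ ?_
  · rcases isEmpty_or_nonempty J with hJ | hJ
    · rw [← top_le_iff]
      rintro ⟨x, hx⟩ -
      rw [iSup_of_empty, mem_bot] at hx
      subst hx
      exact zero_mem _
    · rw [← top_le_iff]
      rintro ⟨x, hx⟩ -
      obtain ⟨j, hj⟩ := (mem_iSup_of_directed _ hS.directed_le).1 hx
      exact mem_iSup_of_mem j hj
  · exact fun j => ((strictSup S j).submoduleOf (S j)).mkQ_surjective.comp (e j).surjective
  · intro j x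
    rw [LinearMap.comp_apply, mkQ_apply, Quotient.mk_eq_zero, mem_strictSup hS',
      ← Submodule.coe_eq_zero (x := (x : (⨆ j, S j : Submodule R P)))]
    exact mem_strictSup hS
  · intro j
    have hex : (ModuleCat.shortComplexOfCompEqZero ((strictSup S j).submoduleOf (S j)).subtype
        ((strictSup S j).submoduleOf (S j)).mkQ (by ext x; simp)).ShortExact :=
      ModuleCat.shortComplex_shortExact _ (LinearMap.exact_subtype_mkQ _)
        (injective_subtype _) (mkQ_surjective _)
    have := h' j
    exact hex.hasProjectiveDimensionLT_X₃ (n + 1)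
      (hasProjectiveDimensionLT_of_iso (submoduleOfEquivOfLe (hlt j)).toModuleIso.symm _) (h j)

end Submodule

/-! ### Closure under finitary operations, and its cardinality. -/

open Cardinal in
theorem Cardinal.mk_finset_le_max (α : Type u) : #(Finset α) ≤ max #α ℵ₀ := by
  rcases finite_or_infinite α with h | h
  · exact (Cardinal.mk_le_aleph0).trans (le_max_right _ _)
  · rw [mk_finset_of_infinite]
    exact le_max_left _ _

/-- A set is closed under a finitary multivalued operation if it contains its values at all
nonempty finite subsets. -/
def FinsetClosed {α : Type u} (φ : Finset α → Finset α) (T : Set α) : Prop :=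
  ∀ s : Finset α, s.Nonempty → (s : Set α) ⊆ T → (φ s : Set α) ⊆ T

/-- The smallest set closed under a finitary multivalued operation and containing a given set. -/
def finsetClosure {α : Type u} (φ : Finset α → Finset α) (A : Set α) : Set α :=
  ⋂₀ {T | A ⊆ T ∧ FinsetClosed φ T}

section Closure

variable {α : Type u} {φ : Finset α → Finset α}

theorem subset_finsetClosure (A : Set α) : A ⊆ finsetClosure φ A :=
  Set.subset_sInter fun _ hT => hT.1

theorem finsetClosure_subset {A T : Set α} (h : A ⊆ T) (hT : FinsetClosed φ T) :
    finsetClosure φ A ⊆ T :=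
  Set.sInter_subset_of_mem ⟨h, hT⟩

theorem finsetClosed_finsetClosure (A : Set α) : FinsetClosed φ (finsetClosure φ A) :=
  fun s hs h => Set.subset_sInter fun _ hT =>
    hT.2 s hs (h.trans (finsetClosure_subset hT.1 hT.2))

theorem finsetClosure_mono {A B : Set α} (h : A ⊆ B) : finsetClosure φ A ⊆ finsetClosure φ B :=
  finsetClosure_subset (h.trans (subset_finsetClosure B)) (finsetClosed_finsetClosure B)

/-- Only nonempty finite sets are tested, so the empty union is closed too; it occurs below the
least index of a filtration. -/
theorem FinsetClosed.iUnion {ι : Type*} {T : ι → Set α} (hd : Directed (· ⊆ ·) T)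
    (h : ∀ i, FinsetClosed φ (T i)) : FinsetClosed φ (⋃ i, T i) := by
  intro s hs hsT
  obtain ⟨x, hx⟩ := hs
  obtain ⟨i₀, -⟩ := Set.mem_iUnion.1 (hsT hx)
  have : Nonempty ι := ⟨i₀⟩
  obtain ⟨i, hi⟩ := hd.exists_mem_subset_of_finset_subset_biUnion hsT
  exact (h i s ⟨x, hx⟩ hi).trans (Set.subset_iUnion T i)

open Cardinal in
-- The closure is reached after countably many rounds of adding the values on finite subsets, and no
-- round exceeds max(#A, ℵ₀).
theorem mk_finsetClosure_le (A : Set α) : #(finsetClosure φ A) ≤ max #A ℵ₀ := by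
  classical
  let F (B : Set α) : Set α :=
    B ∪ ⋃ s : Finset B, (φ (s.map (Function.Embedding.subtype _)) : Set α)
  have hF (B : Set α) : #(F B) ≤ max #B ℵ₀ := by
    refine (mk_union_le _ _).trans (add_le_of_le (le_max_right _ _) (le_max_left _ _) ?_)
    refine (mk_iUnion_le _).trans (mul_le_of_le (le_max_right _ _) (mk_finset_le_max B) ?_)
    exact (ciSup_le' fun s => mk_le_aleph0).trans (le_max_right _ _)
  let stage (n : ℕ) : Set α := F^[n] A
  have hstage (n : ℕ) : stage (n + 1) = F (stage n) := Function.iterate_succ_apply' F n A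
  have hcard (n : ℕ) : #(stage n) ≤ max #A ℵ₀ := by
    induction n with
    | zero => exact le_max_left _ _
    | succ n ih =>
      rw [hstage]
      exact (hF _).trans (max_le ih (le_max_right _ _))
  have hmono : Monotone stage := monotone_nat_of_le_succ fun n => by
    rw [hstage]
    exact Set.subset_union_left
  have hclosed : FinsetClosed φ (⋃ n, stage n) := by
    intro s _ hs
    have hd : Directed (· ⊆ ·) stage := hmono.directed_le
    obtain ⟨n, hn⟩ := hd.exists_mem_subset_of_finset_subset_biUnion hs
    have hmap : (s.subtype (· ∈ stage n)).map (Function.Embedding.subtype _) = s :=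
      Finset.subtype_map_of_mem fun x hx => hn hx
    refine Set.Subset.trans ?_ (Set.subset_iUnion stage (n + 1))
    rw [hstage]
    refine Set.Subset.trans ?_ Set.subset_union_right
    refine Set.subset_iUnion_of_subset (s.subtype (· ∈ stage n)) ?_
    rw [hmap]
  refine (mk_le_mk_of_subset (finsetClosure_subset (Set.subset_iUnion stage 0) hclosed)).trans ?_
  have hle := mk_iUnion_le_lift.{u} stage
  rw [lift_uzero, mk_nat, lift_aleph0] at hle
  refine hle.trans (mul_le_of_le (le_max_right _ _) (le_max_right _ _) ?_)
  exact ciSup_le' fun n => by simpa using hcard n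

end Closure

/-! ### Projective dimension of spans of closed sets. -/

section

variable {R : Type u} [CommRing R] {P : Type u} [AddCommGroup P] [Module R P]

/-- If each nonempty finite subset `s` of a countable set `T` is fixed by an endomorphism whose
range is spanned by a finite subset of `T`, then the span of `T` is projective. -/
theorem projective_span_of_countable [Module.Projective R P] {φ : Finset P → Finset P}
    {θ : Finset P → P →ₗ[R] P} {T : Set P} (hT : T.Countable) (hφ : FinsetClosed φ T)
    (hrange : ∀ s : Finset P, s.Nonempty → (s : Set P) ⊆ T →
      LinearMap.range (θ s) = Submodule.span R (φ s))
    (hfix : ∀ s : Finset P, s.Nonempty → (s : Set P) ⊆ T → ∀ x ∈ s, θ s x = x) :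
    Module.Projective R (Submodule.span R T) := by
  classical
  rcases T.eq_empty_or_nonempty with rfl | hne
  · rw [Submodule.span_empty]
    infer_instance
  obtain ⟨t, rfl⟩ := hT.exists_eq_range hne
  set N := Submodule.span R (Set.range t) with hN
  obtain ⟨S, hS0, hS⟩ : ∃ S : ℕ → Finset P, S 0 = {t 0} ∧
      ∀ n, S (n + 1) = S n ∪ {t (n + 1)} ∪ φ (S n) :=
    ⟨Nat.rec (motive := fun _ => Finset P) {t 0} fun n s => s ∪ {t (n + 1)} ∪ φ s,
      rfl, fun _ => rfl⟩
  have hSmono : Monotone S := monotone_nat_of_le_succ fun n => by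
    rw [hS, Finset.union_assoc]
    exact Finset.subset_union_left
  have htS (n : ℕ) : t n ∈ S n := by
    cases n with
    | zero => simp [hS0]
    | succ n => simp [hS]
  have hSne (n : ℕ) : (S n).Nonempty := ⟨_, htS n⟩
  have hST (n : ℕ) : (S n : Set P) ⊆ Set.range t := by
    induction n with
    | zero => simp [hS0]
    | succ n ih =>
      rw [hS, Finset.coe_union, Finset.coe_union, Finset.coe_singleton]
      exact Set.union_subset (Set.union_subset ih (by simp)) (hφ _ (hSne n) ih)
  have hfixspan (n : ℕ) {x : P} (hx : x ∈ Submodule.span R (S n : Set P)) : θ (S n) x = x := by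
    have : Set.EqOn (θ (S n)) (LinearMap.id : P →ₗ[R] P) (S n : Set P) :=
      fun y hy => hfix _ (hSne n) (hST n) y hy
    exact LinearMap.eqOn_span this hx
  have hθmem (n : ℕ) (x : P) : θ (S n) x ∈ Submodule.span R (S (n + 1) : Set P) := by
    have h1 : θ (S n) x ∈ Submodule.span R (φ (S n) : Set P) := by
      rw [← hrange _ (hSne n) (hST n)]
      exact ⟨x, rfl⟩
    refine Submodule.span_mono ?_ h1
    rw [hS]
    exact_mod_cast Finset.subset_union_right
  have hspanmono {m n : ℕ} (h : m ≤ n) :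
      Submodule.span R (S m : Set P) ≤ Submodule.span R (S n : Set P) :=
    Submodule.span_mono (by exact_mod_cast hSmono h)
  have hev (x : N) : ∃ n, (x : P) ∈ Submodule.span R (S n : Set P) := by
    have hle : N ≤ ⨆ n, Submodule.span R (S n : Set P) := by
      rw [hN, Submodule.span_le]
      rintro _ ⟨n, rfl⟩
      exact Submodule.mem_iSup_of_mem n (Submodule.subset_span (htS n))
    have hd : Directed (· ≤ ·) fun n => Submodule.span R (S n : Set P) :=
      Monotone.directed_le fun _ _ h => hspanmono h
    exact (Submodule.mem_iSup_of_directed _ hd).1 (hle x.2)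
  -- Telescoping: `θ (S n)` fixes a given element of `N` for all large `n`, so its differences `d n`
  -- are eventually zero and sum to it.
  let d (n : ℕ) : P →ₗ[R] P := Nat.casesOn n (θ (S 0)) fun m => θ (S (m + 1)) - θ (S m)
  have hd0 : d 0 = θ (S 0) := rfl
  have hd (m : ℕ) : d (m + 1) = θ (S (m + 1)) - θ (S m) := rfl
  have hdmem (n : ℕ) (x : P) : d n x ∈ Submodule.span R (S (n + 1) : Set P) := by
    cases n with
    | zero => exact hθmem 0 x
    | succ m =>
      rw [hd, LinearMap.sub_apply]
      exact sub_mem (hθmem _ x) (hspanmono (Nat.le_succ _) (hθmem m x))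
  have hdsum (n : ℕ) (x : P) : ∑ i ∈ Finset.range (n + 1), d i x = θ (S n) x := by
    induction n with
    | zero => simp [hd0]
    | succ n ih => rw [Finset.sum_range_succ, ih, hd, LinearMap.sub_apply, add_sub_cancel]
  have hdzero {x : P} {m n : ℕ} (hx : x ∈ Submodule.span R (S m : Set P)) (h : m < n) :
      d n x = 0 := by
    cases n with
    | zero => omega
    | succ k =>
      rw [hd, LinearMap.sub_apply, hfixspan _ (hspanmono h.le hx),
        hfixspan _ (hspanmono (Nat.le_of_lt_succ h) hx), sub_self]
  have hdfin (x : N) : (Function.support fun n => d n x).Finite := by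
    obtain ⟨m, hm⟩ := hev x
    refine (Set.finite_Iic m).subset fun n hn => ?_
    by_contra hle
    exact hn (hdzero hm (not_le.1 hle))
  let i : N →ₗ[R] (ℕ →₀ P) :=
    { toFun := fun x => Finsupp.ofSupportFinite (fun n => d n x) (hdfin x)
      map_add' := fun x y => by ext n; exact map_add (d n) _ _
      map_smul' := fun r x => by ext n; exact map_smul (d n) _ _ }
  have hi (x : N) (n : ℕ) : i x n = d n x := rfl
  have hθN (n : ℕ) (x : P) : θ (S n) x ∈ N := Submodule.span_mono (hST (n + 1)) (hθmem n x)
  -- The shift to `n + 1` matters: `d n x` lies in the span of `S (n + 1)`, which `θ (S (n + 1))`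
  -- fixes. Hence `r` retracts `i`, and `N` is a summand of a projective module.
  let r : (ℕ →₀ P) →ₗ[R] N := Finsupp.lsum ℕ fun n => (θ (S (n + 1))).codRestrict N (hθN (n + 1))
  have : Module.Projective R (ℕ →₀ P) :=
    Module.Projective.of_equiv (finsuppLequivDFinsupp R).symm
  refine Module.Projective.of_split i r (LinearMap.ext fun x => Subtype.ext ?_)
  obtain ⟨m, hm⟩ := hev x
  have hsub : (i x).support ⊆ Finset.range (m + 1) := fun n hn => by
    rw [Finset.mem_range]
    by_contra hle
    exact Finsupp.mem_support_iff.1 hn (hdzero hm (by omega))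
  have hr : r (i x) = ∑ n ∈ Finset.range (m + 1),
      (θ (S (n + 1))).codRestrict N (hθN (n + 1)) (i x n) := by
    simp only [r, Finsupp.lsum_apply]
    exact Finsupp.sum_of_support_subset _ hsub _ fun n _ => map_zero _
  rw [LinearMap.comp_apply, hr, AddSubmonoidClass.coe_finsetSum, LinearMap.id_apply]
  simp only [LinearMap.codRestrict_apply, hi]
  rw [Finset.sum_congr rfl fun n _ => hfixspan (n + 1) (hdmem n x), hdsum, hfixspan m hm]

open Cardinal in
/-- If finite projective dimensions over `R` are bounded by `n`, then so is the projective dimension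
of any submodule of a projective module which is spanned by a set `T` such that each finite subset
of `T` is fixed by an endomorphism with range spanned by a finite subset of `T`. -/
theorem hasProjectiveDimensionLT_span_of_finsetClosed [Module.Projective R P] (n : ℕ)
    (hn : ∀ (M : Type u) [AddCommGroup M] [Module R M] (k : ℕ),
      HasProjectiveDimensionLT (ModuleCat.of R M) k →
      HasProjectiveDimensionLT (ModuleCat.of R M) (n + 1))
    {φ : Finset P → Finset P} {θ : Finset P → P →ₗ[R] P} (T : Set P) (hφ : FinsetClosed φ T)
    (hrange : ∀ s : Finset P, s.Nonempty → (s : Set P) ⊆ T →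
      LinearMap.range (θ s) = Submodule.span R (φ s))
    (hfix : ∀ s : Finset P, s.Nonempty → (s : Set P) ⊆ T → ∀ x ∈ s, θ s x = x) :
    HasProjectiveDimensionLT (ModuleCat.of R (Submodule.span R T)) (n + 1) := by
  induction hc : #T using WellFoundedLT.induction generalizing T with
  | _ c ih =>
    subst hc
    rcases le_or_gt #T ℵ₀ with hT | hT
    · refine hn _ 1 ((hasProjectiveDimensionLT_one_iff_module_projective _).2 ?_)
      exact projective_span_of_countable (le_aleph0_iff_set_countable.1 hT) hφ hrange hfix
    -- Indexing by the initial ordinal makes every initial segment smaller than `T`, and so are the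
    -- closures `A j`.
    let J := (#T).ord.ToType
    have hJ : #J = #T := mk_ord_toType _
    obtain ⟨e⟩ : Nonempty (J ≃ T) := Cardinal.eq.1 hJ
    have hIic (j : J) : #(Set.Iic j) < #T :=
      (mk_Iic_lt j (by rw [hJ, Ordinal.type_toType]) (hT.le.trans_eq hJ.symm)).trans_eq hJ
    have : Nonempty J := e.nonempty_congr.2 (mk_ne_zero_iff.1 (aleph0_pos.trans hT).ne')
    let A (j : J) : Set P := finsetClosure φ ((fun i => (e i : P)) '' Set.Iic j)
    have hA : Monotone A := fun i j hij =>
      finsetClosure_mono (Set.image_mono (Set.Iic_subset_Iic.2 hij))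
    have hAT (j : J) : A j ⊆ T := finsetClosure_subset (by rintro _ ⟨i, -, rfl⟩; exact (e i).2) hφ
    have hAc (j : J) : #(A j) < #T :=
      (mk_finsetClosure_le _).trans_lt (max_lt (mk_image_le.trans_lt (hIic j)) hT)
    have hAu : ⋃ j, A j = T := by
      refine Set.Subset.antisymm (Set.iUnion_subset hAT) fun x hx => ?_
      refine Set.mem_iUnion.2 ⟨e.symm ⟨x, hx⟩, subset_finsetClosure _ ⟨_, Set.self_mem_Iic, ?_⟩⟩
      simp
    have key (B : Set P) (hB : B ⊆ T) (hBφ : FinsetClosed φ B) (hBc : #B < #T) :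
        HasProjectiveDimensionLT (ModuleCat.of R (Submodule.span R B)) (n + 1) :=
      ih _ hBc B hBφ (fun s hs h => hrange s hs (h.trans hB)) (fun s hs h => hfix s hs (h.trans hB))
        rfl
    have hspan : Submodule.span R T = ⨆ j, Submodule.span R (A j) := by
      rw [← Submodule.span_iUnion, hAu]
    rw [hspan]
    -- Auslander's lemma only yields pd ≤ `n + 1`; being finite, this drops to `n` by `hn`.
    refine hn _ (n + 2) (Submodule.hasProjectiveDimensionLT_iSup n
      (fun i j hij => Submodule.span_mono (hA hij)) (fun j => ?_) fun j => ?_)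
    · have := key (A j) (hAT j) (finsetClosed_finsetClosure _) (hAc j)
      exact hasProjectiveDimensionLT_of_ge _ (n + 1) _ (by omega)
    · rw [Submodule.strictSup, ← Submodule.span_iUnion (fun i : Set.Iio j => A i)]
      have hsub : ⋃ i : Set.Iio j, A i ⊆ A j := Set.iUnion_subset fun i => hA i.2.le
      refine key _ (hsub.trans (hAT j)) (FinsetClosed.iUnion ?_ fun i =>
        finsetClosed_finsetClosure _) ((mk_le_mk_of_subset hsub).trans_lt (hAc j))
      exact Monotone.directed_le fun a b hab => hA hab

end

/-! ### Flat modules: Jensen's theorem and vanishing of Ext. -/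

section Flat

variable {R : Type u} [CommRing R] {F : Type u} [AddCommGroup F] [Module R F] [Module.Flat R F]
  {ι : Type u} (g : (ι →₀ R) →ₗ[R] F)

/-- Every finite subset of the kernel of a surjection from a free module onto a flat module is fixed
by an endomorphism of the free module with finitely generated range inside the kernel. -/
theorem Module.Flat.exists_endomorphism_fixing (hg : Function.Surjective g) (s : Finset (ι →₀ R))
    (hs : (s : Set (ι →₀ R)) ⊆ LinearMap.ker g) :
    ∃ (θ : (ι →₀ R) →ₗ[R] (ι →₀ R)) (t : Finset (ι →₀ R)),
      LinearMap.range θ = Submodule.span R t ∧ (t : Set (ι →₀ R)) ⊆ LinearMap.ker g ∧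
        ∀ x ∈ s, θ x = x := by
  classical
  let B : Finset ι := s.biUnion Finsupp.support
  let incl : (B →₀ R) →ₗ[R] (ι →₀ R) := Finsupp.lmapDomain R R Subtype.val
  let res : (ι →₀ R) →ₗ[R] (B →₀ R) :=
    Finsupp.lcomapDomain Subtype.val Subtype.val_injective
  have hres (x : B →₀ R) : res (incl x) = x :=
    Finsupp.comapDomain_mapDomain _ Subtype.val_injective x
  have hincl (x) (hx : x ∈ s) : incl (res x) = x := by
    refine Finsupp.mapDomain_comapDomain _ Subtype.val_injective x fun i hi => ?_
    rw [Subtype.range_coe]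
    exact Finset.mem_biUnion.2 ⟨x, hx, hi⟩
  let f : (s →₀ R) →ₗ[R] (B →₀ R) := Finsupp.linearCombination R fun x : s => res x
  have hf (x : s) : f (Finsupp.single x 1) = res x := by simp [f]
  -- Equational criterion for flatness: the relations in `s` already hold in a finite free module
  -- through which the map to `F` factors.
  obtain ⟨k, a, y, hya, haf⟩ := Module.Flat.exists_factorization_of_comp_eq_zero_of_free
    (f := f) (x := g ∘ₗ incl) (by
      refine Finsupp.lhom_ext' fun x => LinearMap.ext_ring ?_
      simp only [LinearMap.comp_apply, Finsupp.lsingle_apply, hf, hincl _ x.2]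
      exact hs x.2)
  obtain ⟨y', hy'⟩ := Module.projective_lifting_property g y hg
  -- Subtracting the lifted factorization puts the range in `ker g`; nothing changes on `s`, whose
  -- restrictions `a` kills.
  let u : (B →₀ R) →ₗ[R] (ι →₀ R) := incl - y' ∘ₗ a
  have hu : g ∘ₗ u = 0 := by
    rw [LinearMap.comp_sub, ← LinearMap.comp_assoc, hy', hya, sub_self]
  obtain ⟨t, ht⟩ := Module.Finite.iff_fg.1 (Module.Finite.range u)
  refine ⟨u ∘ₗ res, t, ?_, ?_, fun x hx => ?_⟩
  · rw [ht, LinearMap.range_comp_of_range_eq_top]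
    exact LinearMap.range_eq_top.2 fun x => ⟨_, hres x⟩
  · intro x hx
    have hx' : x ∈ LinearMap.range u := ht ▸ Submodule.subset_span hx
    obtain ⟨z, rfl⟩ := hx'
    exact LinearMap.congr_fun hu z
  · have h0 := LinearMap.congr_fun haf (Finsupp.single ⟨x, hx⟩ 1)
    rw [LinearMap.comp_apply, hf, LinearMap.zero_apply] at h0
    simp only [u, LinearMap.comp_apply, LinearMap.sub_apply, h0, map_zero, sub_zero, hincl x hx]

/-- A relation in the kernel is trivial in the free module; an endomorphism fixing the elements
involved moves the witnesses into the kernel. -/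
theorem Module.Flat.ker_of_surjective (hg : Function.Surjective g) :
    Module.Flat R (LinearMap.ker g) := by
  classical
  refine Module.Flat.of_forall_isTrivialRelation (R := R) (M := LinearMap.ker g) ?_
  intro l f x hfx
  have hP : ∑ i, f i • (x i : ι →₀ R) = 0 := by
    simpa using congrArg (LinearMap.ker g).subtype hfx
  obtain ⟨k, a, y, (hy : ∀ i, (x i : ι →₀ R) = _), ha⟩ :=
    Module.Flat.isTrivialRelation_of_sum_smul_eq_zero hP
  obtain ⟨θ, t, hrange, ht, hfix⟩ := Module.Flat.exists_endomorphism_fixing g hg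
    (Finset.univ.image fun i => (x i : ι →₀ R)) (by
      intro z hz
      obtain ⟨i, -, rfl⟩ := Finset.mem_image.1 (Finset.mem_coe.1 hz)
      exact (x i).2)
  have hθ (z) : θ z ∈ LinearMap.ker g :=
    Submodule.span_le.2 ht (hrange ▸ LinearMap.mem_range_self θ z)
  refine ⟨k, a, fun j => ⟨θ (y j), hθ _⟩, fun i => Subtype.ext ?_, ha⟩
  rw [← hfix (x i) (Finset.mem_image_of_mem _ (Finset.mem_univ i)), hy i]
  simp

/-- **Jensen's theorem**: if the finite projective dimensions over `R` are bounded, then flat modules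
have finite projective dimension. -/
theorem Module.Flat.hasProjectiveDimensionLT_of_bounded (n : ℕ)
    (hn : ∀ (M : Type u) [AddCommGroup M] [Module R M] (k : ℕ),
      HasProjectiveDimensionLT (ModuleCat.of R M) k →
      HasProjectiveDimensionLT (ModuleCat.of R M) (n + 1))
    (F : Type u) [AddCommGroup F] [Module R F] [Module.Flat R F] :
    HasProjectiveDimensionLT (ModuleCat.of R F) (n + 1) := by
  classical
  let g : (F →₀ R) →ₗ[R] F := Finsupp.linearCombination R id
  have hg : Function.Surjective g := Finsupp.linearCombination_id_surjective R F
  have hex (s : Finset (F →₀ R)) : ∃ (θ : (F →₀ R) →ₗ[R] (F →₀ R)) (t : Finset (F →₀ R)),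
      (s : Set (F →₀ R)) ⊆ LinearMap.ker g →
      LinearMap.range θ = Submodule.span R t ∧ (t : Set (F →₀ R)) ⊆ LinearMap.ker g ∧
        ∀ x ∈ s, θ x = x := by
    by_cases hs : (s : Set (F →₀ R)) ⊆ LinearMap.ker g
    · obtain ⟨θ, t, h⟩ := Module.Flat.exists_endomorphism_fixing g hg s hs
      exact ⟨θ, t, fun _ => h⟩
    -- Default values that make the choice total; they are never used on subsets of the kernel.
    · exact ⟨0, ∅, fun h => absurd h hs⟩
  choose θ φ h using hex
  have hker := hasProjectiveDimensionLT_span_of_finsetClosed n hn (φ := φ) (θ := θ)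
    (LinearMap.ker g : Set (F →₀ R)) (fun s _ hs => (h s hs).2.1) (fun s _ hs => (h s hs).1)
    (fun s _ hs => (h s hs).2.2)
  rw [Submodule.span_eq] at hker
  exact hn F (n + 2) (HasProjectiveDimensionLT.of_ker_of_projective g hg n hker)

/-- Ext^{n+2}(F, Y) is a quotient of Ext^{n+1}(K, Y) for the flat kernel K of a free presentation.
So vanishing in the single degree defining cd persists in higher degrees. -/
theorem subsingleton_ext_succ_of_flat {Y : ModuleCat.{u} R} {n : ℕ}
    (h : ∀ F : ModuleCat.{u} R, Module.Flat R F → Subsingleton (Abelian.Ext.{u} F Y (n + 1)))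
    (F : ModuleCat.{u} R) (hF : Module.Flat R F) :
    Subsingleton (Abelian.Ext.{u} F Y (n + 2)) := by
  let g : (F →₀ R) →ₗ[R] F := Finsupp.linearCombination R id
  have hg : Function.Surjective g := Finsupp.linearCombination_id_surjective R F
  have hS := LinearMap.shortExact_shortComplexKer hg
  have hK := h (ModuleCat.of R (LinearMap.ker g)) (Module.Flat.ker_of_surjective g hg)
  have : HasProjectiveDimensionLT (ModuleCat.of R (F →₀ R)) 1 :=
    (hasProjectiveDimensionLT_one_iff_module_projective _).2 inferInstance
  refine subsingleton_of_forall_eq 0 fun x => ?_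
  obtain ⟨x₁, rfl⟩ := Abelian.Ext.contravariant_sequence_exact₃ hS Y x
    (Abelian.Ext.eq_zero_of_hasProjectiveDimensionLT (X := ModuleCat.of R (F →₀ R)) _ 1 (by omega))
    (n₀ := n + 1) (by omega)
  rw [hK.elim x₁ 0, Abelian.Ext.comp_zero]

theorem hasProjectiveDimensionLT_of_flat {c : ℕ}
    (h : ∀ Y : ModuleCat.{u} R, ∃ m ≤ c, ∀ F : ModuleCat.{u} R, Module.Flat R F →
      Subsingleton (Abelian.Ext.{u} F Y (m + 1)))
    (F : ModuleCat.{u} R) (hF : Module.Flat R F) : HasProjectiveDimensionLT F (c + 1) := by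
  refine hasProjectiveDimensionLT_of_enoughInjectives.{u} F (c + 1) fun Y => ?_
  obtain ⟨m, hm, hY⟩ := h Y
  have H (k : ℕ) (hk : m ≤ k) : ∀ F : ModuleCat.{u} R, Module.Flat R F →
      Subsingleton (Abelian.Ext.{u} F Y (k + 1)) := by
    induction k, hk using Nat.le_induction with
    | base => exact hY
    | succ k _ ih => exact subsingleton_ext_succ_of_flat ih
  exact H c hm F hF

end Flat

/-! ### Comparison of the dimensions and the two inequalities. -/

section Dimensions

variable {R : Type u} [CommRing R]

theorem projDim_le_iff (M : ModuleCat.{u} R) (n : ℕ) :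
    projDim M ≤ n ↔ HasProjectiveDimensionLT M (n + 1) := by
  refine Iff.trans ?_ (projectiveDimension_le_iff M n)
  rw [projDim, WithBot.unbotD_le_iff (fun _ => zero_le)]
  rfl

theorem flatDim_le_of_hasFlatResolutionOfLength {M : ModuleCat.{u} R} {n : ℕ}
    (h : HasFlatResolutionOfLength R n M) : flatDim M ≤ n :=
  iInf₂_le n h

theorem ENat.exists_le_of_iInf_le {p : ℕ → Prop} {n : ℕ}
    (h : ⨅ (m : ℕ) (_ : p m), (m : ℕ∞) ≤ n) : ∃ m ≤ n, p m := by
  by_contra! hcon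
  have : ((n + 1 : ℕ) : ℕ∞) ≤ ⨅ (m : ℕ) (_ : p m), (m : ℕ∞) :=
    le_iInf₂ fun m hm => by
      have : n < m := by
        by_contra hle
        exact hcon m (not_lt.1 hle) hm
      exact_mod_cast this
  have := this.trans h
  norm_cast at this
  omega

theorem hasFlatResolutionOfLength_of_hasProjectiveDimensionLT {n : ℕ} {M : ModuleCat.{u} R}
    (h : HasProjectiveDimensionLT M (n + 1)) : HasFlatResolutionOfLength R n M := by
  induction n generalizing M with
  | zero =>
    have : Module.Projective R M := (hasProjectiveDimensionLT_one_iff_module_projective M).1 h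
    exact Module.Flat.of_projective
  | succ n ih =>
    let g : (M →₀ R) →ₗ[R] M := Finsupp.linearCombination R id
    have hg : Function.Surjective g := Finsupp.linearCombination_id_surjective R M
    exact ⟨ModuleCat.of R (LinearMap.ker g), ModuleCat.of R (M →₀ R), (LinearMap.ker g).subtype, g,
      Submodule.injective_subtype _, LinearMap.exact_subtype_ker_map g, hg,
      inferInstanceAs (Module.Flat R (M →₀ R)),
      ih (HasProjectiveDimensionLT.ker_of_projective g hg n h)⟩

/-- Each short exact sequence of the flat resolution raises the bound by one, starting from `c` at
the last flat kernel. -/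
theorem hasProjectiveDimensionLT_of_hasFlatResolutionOfLength {c d : ℕ}
    (hc : ∀ F : ModuleCat.{u} R, Module.Flat R F → HasProjectiveDimensionLT F (c + 1))
    {M : ModuleCat.{u} R} (h : HasFlatResolutionOfLength R d M) :
    HasProjectiveDimensionLT M (c + d + 1) := by
  induction d generalizing M with
  | zero => exact hc M h
  | succ d ih =>
    obtain ⟨K, F, f, g, hf, hfg, hg, hF, hK⟩ := h
    have hS : (ModuleCat.shortComplexOfCompEqZero f g hfg.linearMap_comp_eq_zero).ShortExact :=
      ModuleCat.shortComplex_shortExact _ hfg hf hg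
    have := hc F hF
    exact hS.hasProjectiveDimensionLT_X₃ (c + d + 1) (ih hK)
      (hasProjectiveDimensionLT_of_ge F (c + 1) _ (by omega))

theorem flatDim_le_projDim (M : ModuleCat.{u} R) : flatDim M ≤ projDim M := by
  rcases eq_or_ne (projDim M) ⊤ with h | h
  · exact h ▸ le_top
  · obtain ⟨n, hn⟩ := ENat.ne_top_iff_exists.1 h
    rw [← hn]
    exact flatDim_le_of_hasFlatResolutionOfLength
      (hasFlatResolutionOfLength_of_hasProjectiveDimensionLT ((projDim_le_iff M n).1 hn.ge))

theorem projDim_le_finitisticProjDim {M : ModuleCat.{u} R} (h : projDim M < ⊤) :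
    projDim M ≤ finitisticProjDim R :=
  le_iSup₂ (f := fun (M : ModuleCat.{u} R) (_ : projDim M < ⊤) => projDim M) M h

theorem flatDim_le_finitisticFlatDim {M : ModuleCat.{u} R} (h : flatDim M < ⊤) :
    flatDim M ≤ finitisticFlatDim R :=
  le_iSup₂ (f := fun (M : ModuleCat.{u} R) (_ : flatDim M < ⊤) => flatDim M) M h

theorem finitisticFlatDim_le_finitisticProjDim (R : Type u) [CommRing R] :
    finitisticFlatDim R ≤ finitisticProjDim R := by
  rcases eq_or_ne (finitisticProjDim R) ⊤ with h | h
  · exact h ▸ le_top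
  obtain ⟨n, hn⟩ := ENat.ne_top_iff_exists.1 h
  have hbound (M : Type u) [AddCommGroup M] [Module R M] (k : ℕ)
      (hk : HasProjectiveDimensionLT (ModuleCat.of R M) k) :
      HasProjectiveDimensionLT (ModuleCat.of R M) (n + 1) := by
    rw [← projDim_le_iff, hn]
    exact projDim_le_finitisticProjDim
      (((projDim_le_iff _ k).2
        (hasProjectiveDimensionLT_of_ge _ k (k + 1) (by omega))).trans_lt (ENat.natCast_lt_top k))
  refine iSup₂_le fun M hM => ?_
  obtain ⟨p, hp⟩ := ENat.ne_top_iff_exists.1 hM.ne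
  obtain ⟨m, -, hm⟩ := ENat.exists_le_of_iInf_le hp.ge
  -- Only the finiteness of this bound matters: it puts `M` among the modules over which FPD is the
  -- supremum.
  have hpd : projDim M ≤ (n + m : ℕ) := (projDim_le_iff _ _).2
    (hasProjectiveDimensionLT_of_hasFlatResolutionOfLength
      (fun F _ => Module.Flat.hasProjectiveDimensionLT_of_bounded n hbound F) hm)
  exact (flatDim_le_projDim M).trans
    (projDim_le_finitisticProjDim (hpd.trans_lt (ENat.natCast_lt_top _)))

theorem finitisticProjDim_le_globalCotorsionDim_add (R : Type u) [CommRing R] :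
    finitisticProjDim R ≤ globalCotorsionDim R + finitisticFlatDim R := by
  rcases eq_or_ne (globalCotorsionDim R) ⊤ with hcot | hcot
  · rw [hcot, top_add]
    exact le_top
  rcases eq_or_ne (finitisticFlatDim R) ⊤ with hflat | hflat
  · rw [hflat, add_top]
    exact le_top
  obtain ⟨c, hc⟩ := ENat.ne_top_iff_exists.1 hcot
  obtain ⟨d, hd⟩ := ENat.ne_top_iff_exists.1 hflat
  refine iSup₂_le fun M hM => ?_
  have hMd : flatDim M ≤ d :=
    hd ▸ flatDim_le_finitisticFlatDim ((flatDim_le_projDim M).trans_lt hM)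
  obtain ⟨m, hmd, hm⟩ := ENat.exists_le_of_iInf_le hMd
  have hcY (Y : ModuleCat.{u} R) : cotorsionDim Y ≤ c :=
    hc ▸ le_iSup (fun Y : ModuleCat.{u} R => cotorsionDim Y) Y
  have hpd : projDim M ≤ (c + m : ℕ) := (projDim_le_iff _ _).2
    (hasProjectiveDimensionLT_of_hasFlatResolutionOfLength
      (hasProjectiveDimensionLT_of_flat fun Y => ENat.exists_le_of_iInf_le (hcY Y)) hm)
  rw [← hc, ← hd]
  refine hpd.trans ?_
  exact_mod_cast Nat.add_le_add_left hmd c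

end Dimensions

theorem theorem2p2 (R : Type u) [CommRing R] :
    finitisticFlatDim R ≤ finitisticProjDim R ∧
      finitisticProjDim R ≤ globalCotorsionDim R + finitisticFlatDim R :=
  ⟨finitisticFlatDim_le_finitisticProjDim R, finitisticProjDim_le_globalCotorsionDim_add R⟩
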